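/- Let $n\ge 1$ be an integer. Let $(\tilde\Psi_m)_{m\ge 0}$, $(\tilde V_m)_{m\ge 1}$ be sequences of $C^2$ functions $\mathbb R\to\mathbb R$ that are $2\pi$-periodic, and $(\tilde E_m)_{m\ge 0}$ a sequence of real numbers, such that $\tilde\Psi_0(x)=\cos(nx)$, $\tilde E_0=1$, and for all $m\ge 1$ and $x\in\mathbb R$ $$\Big(\frac1{n^2}\frac{d^2}{dx^2}+1\Big)\tilde\Psi_m(x)=\sum_{j=1}^m\tilde\Psi_{m-j}(x)\big[\tilde V_j(x)-\tilde E_j\big],$$ $$\frac1{n^2}\frac{d^2\tilde V_m}{dx^2}(x)=8\Big[\sum_{j=1}^m\tilde\Psi_{m-j}(x)\tilde\Psi_{j-1}(x)-\tilde\Lambda_{m-1}\Big],\qquad \tilde\Lambda_{m-1}=\frac1{2\pi}\int_0^{2\pi}\sum_{j=1}^m\tilde\Psi_{m-j}(y)\tilde\Psi_{j-1}(y)\,dy,$$ with the normalizations $\int_0^{2\pi}\tilde V_m\,dx=0$, $\tilde\Psi_m(-x)=\tilde\Psi_m(x)$ and $\int_0^{2\pi}\tilde\Psi_m\tilde\Psi_0\,dx=0$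 for all $m\ge 1$. (These are the order-by-order equations, in the density parameter $\tilde\rho$, of the periodic equilibrium of the one-dimensional Schrödinger–Poisson system that emanates from the standing wave $\cos(nx)$.) Let $$\tilde\rho^{(c)}=\Big(\max\Big\{\limsup_{m\to\infty}|\tilde E_m|^{1/m},\ \limsup_{m\to\infty}\big(\max_{[0,2\pi]}|\tilde\Psi_m|\big)^{1/m},\ \limsup_{m\to\infty}\big(\max_{[0,2\pi]}|\tilde V_m|\big)^{1/m}\Big\}\Big)^{-1}\in[0,\infty]$$ be the radius of convergence, and let $\tilde\Psi_{eq}(\tilde\rho,x)=\sum_{m\ge 0}\tilde\rho^{\,m}\tilde\Psi_m(x)$. Then, for every $\tilde\rho\in[0,\tilde\rho^{(c)})$, the series defining $\tilde\Psi_{eq}(\tilde\rho,x)$ converges for every $x\in\mathbb R$, and $\tilde\Psi_{eq}(\tilde\rho,\cdot)$ has exactly two nodes (zeros) in $[0,2\pi/n]$, namely $x=\pi/(2n)$ and $x=3\pi/(2n)$. Moreover it has exactly one node in each lattice cell $[k\pi/n,(k+1)\pi/n]$, $k\in\mathbb Z$, namely the midpoint $(2k+1)\pi/(2n)$. -/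

import Mathlib

open Set Filter MeasureTheory
open scoped ENNReal Real

/-- The kinetic energy `n² / 2` of the plane wave with wave number `n` (units `ħ = m = 1`). -/
noncomputable def planeWaveEnergy (n : ℕ) : ℝ := (n : ℝ) ^ 2 / 2

/-- The order-`m` contribution `∑_{j=1}^m Ψ_{m-j} Ψ_{j-1}` to the normalized mass density. -/
noncomputable def densityOrder (Ψ : ℕ → ℝ → ℝ) (m : ℕ) (x : ℝ) : ℝ :=
  ∑ j ∈ Finset.Icc 1 m, Ψ (m - j) x * Ψ (j - 1) x

/-- The normalized cosmological constant `Λ_{m-1}`: the mean of `densityOrder Ψ m` over `[0, 2π]`. -/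
noncomputable def cosmologicalOrder (Ψ : ℕ → ℝ → ℝ) (m : ℕ) : ℝ :=
  1 / (2 * π) * ∫ y in (0 : ℝ)..(2 * π), densityOrder Ψ m y

/-- `Ψ`, `V`, `E` are the Taylor coefficients, with respect to the density parameter, of the
normalized wave function, gravitational potential and eigenenergy of the periodic equilibrium of
the Schrödinger-Poisson system that emanates from the standing wave `cos (n x)`. -/
structure IsBackgroundExpansion (n : ℕ) (Ψ V : ℕ → ℝ → ℝ) (E : ℕ → ℝ) : Prop where
  wave_zero : ∀ x, Ψ 0 x = Real.cos (n * x)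
  potential_zero : ∀ x, V 0 x = 0
  energy_zero : E 0 = 1
  wave_contDiff : ∀ m, ContDiff ℝ 2 (Ψ m)
  potential_contDiff : ∀ m, ContDiff ℝ 2 (V m)
  wave_periodic : ∀ m x, Ψ m (x + 2 * π) = Ψ m x
  potential_periodic : ∀ m x, V m (x + 2 * π) = V m x
  /-- The gauge of the potential: every order has zero mean. -/
  potential_mean : ∀ m, ∫ x in (0 : ℝ)..(2 * π), V m x = 0
  /-- The order-`m` part of the Schrödinger equation. -/
  schrodinger : ∀ m, 1 ≤ m → ∀ x,
    1 / (2 * planeWaveEnergy n) * deriv (deriv (Ψ m)) x + Ψ m x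
      = ∑ j ∈ Finset.Icc 1 m, Ψ (m - j) x * (V j x - E j)
  /-- The order-`m` part of the Poisson equation. -/
  poisson : ∀ m, 1 ≤ m → ∀ x,
    1 / (2 * planeWaveEnergy n) * deriv (deriv (V m)) x
      = 8 * (densityOrder Ψ m x - cosmologicalOrder Ψ m)
  /-- The standing wave is even. -/
  wave_even : ∀ m x, Ψ m (-x) = Ψ m x
  /-- The corrections are orthogonal to the leading order; together with evenness this removes
  the solutions of the homogeneous Schrödinger equation at each order. -/
  wave_orthogonal : ∀ m, 1 ≤ m → ∫ x in (0 : ℝ)..(2 * π), Ψ m x * Ψ 0 x = 0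

/-- `max_{x ∈ [0, 2π]} |f x|`, as an extended nonnegative real. -/
noncomputable def maxAbs (f : ℝ → ℝ) : ℝ≥0∞ := ⨆ x ∈ Icc (0 : ℝ) (2 * π), ‖f x‖ₑ

/-- The growth rate `limsup (a m)^(1/m)` of the root test. -/
noncomputable def rootRate (a : ℕ → ℝ≥0∞) : ℝ≥0∞ :=
  limsup (fun m : ℕ => a m ^ (1 / (m : ℝ))) atTop

/-- The radius of convergence `ρ_c` of the background configuration: the inverse of the largest of
the growth rates of the eigenenergy, the wave function and the potential. -/
noncomputable def backgroundRadius (Ψ V : ℕ → ℝ → ℝ) (E : ℕ → ℝ) : ℝ≥0∞ :=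
  (max (rootRate fun m => ‖E m‖ₑ)
    (max (rootRate fun m => maxAbs (Ψ m)) (rootRate fun m => maxAbs (V m))))⁻¹

/-- The normalized equilibrium wave function with density parameter `ρ`. -/
noncomputable def backgroundWave (Ψ : ℕ → ℝ → ℝ) (ρ x : ℝ) : ℝ := ∑' m : ℕ, ρ ^ m * Ψ m x

/-! Existence of the expansion, order by order, in the span of the functions `cos (k n x)`. -/

/-- The even trigonometric polynomials in `n x`. -/
noncomputable def cosSpan (n : ℕ) : Submodule ℝ (ℝ → ℝ) :=
  Submodule.span ℝ (range fun (k : ℕ) (x : ℝ) => Real.cos (k * n * x))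

theorem cos_mem_cosSpan (n k : ℕ) : (fun x : ℝ => Real.cos (k * n * x)) ∈ cosSpan n :=
  Submodule.subset_span ⟨k, rfl⟩

theorem mul_mem_cosSpan {n : ℕ} {f g : ℝ → ℝ} (hf : f ∈ cosSpan n) (hg : g ∈ cosSpan n) :
    f * g ∈ cosSpan n := by
  have h : cosSpan n * cosSpan n ≤ cosSpan n := by
    unfold cosSpan
    rw [Submodule.span_mul_span, Submodule.span_le]
    rintro _ ⟨_, ⟨k, rfl⟩, _, ⟨l, rfl⟩, rfl⟩
    wlog hkl : l ≤ k generalizing k l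
    · have := this l k (by omega)
      simpa only [mul_comm] using this
    have h1 := cos_mem_cosSpan n (k + l)
    have h2 := cos_mem_cosSpan n (k - l)
    have h3 := (cosSpan n).smul_mem (1 / 2 : ℝ) ((cosSpan n).add_mem h1 h2)
    refine (congrArg (· ∈ cosSpan n) (funext fun x => ?_)).mpr h3
    simp only [Pi.mul_apply, Pi.smul_apply, Pi.add_apply, smul_eq_mul]
    push_cast [Nat.cast_sub hkl]
    rw [show ((k : ℝ) + l) * n * x = k * n * x + l * n * x by ring,
      show ((k : ℝ) - l) * n * x = k * n * x - l * n * x by ring, Real.cos_add, Real.cos_sub]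
    ring
  exact h (Submodule.mul_mem_mul hf hg)

theorem contDiff_of_mem_cosSpan {n : ℕ} {f : ℝ → ℝ} (hf : f ∈ cosSpan n) : ContDiff ℝ 2 f := by
  unfold cosSpan at hf
  induction hf using Submodule.span_induction with
  | mem f h => obtain ⟨k, rfl⟩ := h; fun_prop
  | zero => exact contDiff_const
  | add f g _ _ hf hg => exact hf.add hg
  | smul a f _ hf => exact contDiff_const.smul hf

theorem even_of_mem_cosSpan {n : ℕ} {f : ℝ → ℝ} (hf : f ∈ cosSpan n) (x : ℝ) :
    f (-x) = f x := by
  unfold cosSpan at hf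
  induction hf using Submodule.span_induction with
  | mem f h => obtain ⟨k, rfl⟩ := h; simp
  | zero => simp
  | add f g _ _ hf hg => simp [hf, hg]
  | smul a f _ hf => simp [hf]

theorem periodic_of_mem_cosSpan {n : ℕ} {f : ℝ → ℝ} (hf : f ∈ cosSpan n) (x : ℝ) :
    f (x + 2 * π) = f x := by
  unfold cosSpan at hf
  induction hf using Submodule.span_induction with
  | mem f h =>
    obtain ⟨k, rfl⟩ := h
    have := Real.cos_add_nat_mul_two_pi (k * n * x) (k * n)
    push_cast at this
    simp only [mul_add, this]
  | zero => simp
  | add f g _ _ hf hg => simp [hf, hg]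
  | smul a f _ hf => simp [hf]

theorem deriv_deriv_add_smul {f g : ℝ → ℝ} (hf : ContDiff ℝ 2 f) (hg : ContDiff ℝ 2 g)
    (a b x : ℝ) : deriv (deriv (a • f + b • g)) x
      = a * deriv (deriv f) x + b * deriv (deriv g) x := by
  have hf1 : Differentiable ℝ f := hf.differentiable (by norm_num)
  have hg1 : Differentiable ℝ g := hg.differentiable (by norm_num)
  have hf2 : Differentiable ℝ (deriv f) := by
    have := hf.differentiable_iteratedDeriv 1 (by norm_num)
    simpa [iteratedDeriv_one] using this
  have hg2 : Differentiable ℝ (deriv g) := by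
    have := hg.differentiable_iteratedDeriv 1 (by norm_num)
    simpa [iteratedDeriv_one] using this
  have h : deriv (a • f + b • g) = a • deriv f + b • deriv g := by
    ext y
    exact (((hf1 y).hasDerivAt.const_smul a).add ((hg1 y).hasDerivAt.const_smul b)).deriv
  rw [h]
  exact (((hf2 x).hasDerivAt.const_smul a).add ((hg2 x).hasDerivAt.const_smul b)).deriv

theorem deriv_deriv_cos_mul (c x : ℝ) :
    deriv (deriv fun x => Real.cos (c * x)) x = -c ^ 2 * Real.cos (c * x) := by
  have h : deriv (fun x => Real.cos (c * x)) = fun x => -c * Real.sin (c * x) := by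
    ext y
    have := ((hasDerivAt_id y).const_mul c).cos
    simp only [id, mul_one] at this
    rw [this.deriv]; ring
  rw [h]
  have := (((hasDerivAt_id x).const_mul c).sin).const_mul (-c)
  simp only [id, mul_one] at this
  rw [this.deriv]; ring

theorem integral_cos_int_mul {k : ℤ} (hk : k ≠ 0) :
    ∫ x in (0 : ℝ)..(2 * π), Real.cos (k * x) = 0 := by
  have hk' : (k : ℝ) ≠ 0 := by exact_mod_cast hk
  rw [intervalIntegral.integral_comp_mul_left (f := Real.cos) hk', integral_cos]
  have h := Real.sin_int_mul_pi (2 * k)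
  push_cast at h
  rw [show (k : ℝ) * (2 * π) = 2 * k * π by ring, h]
  simp

theorem intervalIntegrable_of_mem_cosSpan {n : ℕ} {f : ℝ → ℝ} (hf : f ∈ cosSpan n) (a b : ℝ) :
    IntervalIntegrable f volume a b :=
  (contDiff_of_mem_cosSpan hf).continuous.intervalIntegrable a b

theorem integral_add_smul_of_mem_cosSpan {n : ℕ} {f g : ℝ → ℝ} (hf : f ∈ cosSpan n)
    (hg : g ∈ cosSpan n) (a b : ℝ) :
    ∫ x in (0 : ℝ)..(2 * π), (a • f + b • g) x
      = a * (∫ x in (0 : ℝ)..(2 * π), f x) + b * ∫ x in (0 : ℝ)..(2 * π), g x := by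
  simp only [Pi.add_apply, Pi.smul_apply, smul_eq_mul]
  rw [intervalIntegral.integral_add ((intervalIntegrable_of_mem_cosSpan hf _ _).const_mul a)
    ((intervalIntegrable_of_mem_cosSpan hg _ _).const_mul b),
    intervalIntegral.integral_const_mul, intervalIntegral.integral_const_mul]

theorem exists_poisson {n : ℕ} (hn : 0 < n) {f : ℝ → ℝ} (hf : f ∈ cosSpan n) :
    ∃ v ∈ cosSpan n, (∫ x in (0 : ℝ)..(2 * π), v x = 0) ∧
      ∀ x, 1 / (2 * planeWaveEnergy n) * deriv (deriv v) x
        = f x - 1 / (2 * π) * ∫ y in (0 : ℝ)..(2 * π), f y := by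
  have hn' : (n : ℝ) ≠ 0 := by exact_mod_cast hn.ne'
  have hf' := hf
  unfold cosSpan at hf
  induction hf using Submodule.span_induction with
  | mem f h =>
    obtain ⟨k, rfl⟩ := h
    rcases Nat.eq_zero_or_pos k with rfl | hk
    · refine ⟨0, zero_mem _, by simp, fun x => ?_⟩
      have h0 : deriv (0 : ℝ → ℝ) = 0 := by ext; simp
      simp [h0]
      field_simp
      norm_num
    · have hk' : (k : ℝ) ≠ 0 := by exact_mod_cast hk.ne'
      have hi : ∫ x in (0 : ℝ)..(2 * π), Real.cos (k * n * x) = 0 := by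
        have := integral_cos_int_mul (k := k * n) (by positivity)
        push_cast at this
        exact this
      have hc := cos_mem_cosSpan n k
      refine ⟨(-1 / (k : ℝ) ^ 2) • (fun x : ℝ => Real.cos (k * n * x))
          + (0 : ℝ) • (fun x : ℝ => Real.cos (k * n * x)),
        add_mem (Submodule.smul_mem _ _ hc) (Submodule.smul_mem _ _ hc), ?_, fun x => ?_⟩
      · rw [integral_add_smul_of_mem_cosSpan hc hc, hi]; simp
      · rw [deriv_deriv_add_smul (contDiff_of_mem_cosSpan hc) (contDiff_of_mem_cosSpan hc),
          deriv_deriv_cos_mul, hi]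
        unfold planeWaveEnergy
        field_simp
        ring
  | zero =>
    refine ⟨0, zero_mem _, by simp, fun x => ?_⟩
    have h0 : deriv (0 : ℝ → ℝ) = 0 := by ext; simp
    simp [h0]
  | add f g hfm hgm hf hg =>
    obtain ⟨u, hu, hu0, hu'⟩ := hf hfm
    obtain ⟨v, hv, hv0, hv'⟩ := hg hgm
    refine ⟨(1 : ℝ) • u + (1 : ℝ) • v, by simpa using add_mem hu hv, ?_, fun x => ?_⟩
    · rw [integral_add_smul_of_mem_cosSpan hu hv, hu0, hv0]; simp
    · have := integral_add_smul_of_mem_cosSpan hfm hgm 1 1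
      simp only [one_smul] at this
      rw [deriv_deriv_add_smul (contDiff_of_mem_cosSpan hu) (contDiff_of_mem_cosSpan hv), this]
      have h1 := hu' x
      have h2 := hv' x
      simp only [Pi.add_apply]
      linear_combination h1 + h2
  | smul a f hfm hf =>
    obtain ⟨u, hu, hu0, hu'⟩ := hf hfm
    refine ⟨a • u + (0 : ℝ) • u, by simpa using Submodule.smul_mem _ a hu, ?_, fun x => ?_⟩
    · rw [integral_add_smul_of_mem_cosSpan hu hu, hu0]; simp
    · have := integral_add_smul_of_mem_cosSpan hfm hfm a 0
      simp only [zero_smul, add_zero, zero_mul] at this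
      rw [deriv_deriv_add_smul (contDiff_of_mem_cosSpan hu) (contDiff_of_mem_cosSpan hu), this]
      have h1 := hu' x
      simp only [Pi.smul_apply, smul_eq_mul]
      linear_combination a * h1

theorem exists_schrodinger {n : ℕ} (hn : 0 < n) {f : ℝ → ℝ} (hf : f ∈ cosSpan n) :
    ∃ u ∈ cosSpan n, ∃ c : ℝ, (∫ x in (0 : ℝ)..(2 * π), u x * Real.cos (n * x) = 0) ∧
      ∀ x, 1 / (2 * planeWaveEnergy n) * deriv (deriv u) x + u x
        = f x - c * Real.cos (n * x) := by
  have hn' : (n : ℝ) ≠ 0 := by exact_mod_cast hn.ne'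
  have h0 : deriv (0 : ℝ → ℝ) = 0 := by ext; simp
  have hone : (fun x : ℝ => Real.cos (n * x)) ∈ cosSpan n := by
    simpa using cos_mem_cosSpan n 1
  have hint : ∀ {u v : ℝ → ℝ}, u ∈ cosSpan n → v ∈ cosSpan n → ∀ a b : ℝ,
      (∫ x in (0 : ℝ)..(2 * π), u x * Real.cos (n * x) = 0) →
      (∫ x in (0 : ℝ)..(2 * π), v x * Real.cos (n * x) = 0) →
      ∫ x in (0 : ℝ)..(2 * π), (a • u + b • v) x * Real.cos (n * x) = 0 := by
    intro u v hu hv a b h1 h2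
    have := integral_add_smul_of_mem_cosSpan (mul_mem_cosSpan hu hone) (mul_mem_cosSpan hv hone) a b
    simp only [Pi.mul_apply] at this
    rw [h1, h2] at this
    rw [mul_zero, mul_zero, add_zero] at this
    rw [← this]
    congr 1
    ext x
    simp only [Pi.add_apply, Pi.smul_apply, Pi.mul_apply, smul_eq_mul]
    ring
  unfold cosSpan at hf
  induction hf using Submodule.span_induction with
  | mem f h =>
    obtain ⟨k, rfl⟩ := h
    rcases eq_or_ne k 1 with rfl | hk
    · exact ⟨0, zero_mem _, 1, by simp, fun x => by simp [h0]⟩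
    · have hk1 : (1 - (k : ℝ) ^ 2) ≠ 0 := by
        intro h
        have h' : (k : ℝ) ^ 2 = 1 := by linarith
        have : k ^ 2 = 1 := by exact_mod_cast h'
        exact hk (by nlinarith [this])
      have hi : ∫ x in (0 : ℝ)..(2 * π), Real.cos (k * n * x) * Real.cos (n * x) = 0 := by
        have e1 := integral_cos_int_mul (k := (k + 1) * n) (by positivity)
        have e2 := integral_cos_int_mul (k := (k - 1) * n) (by
          refine mul_ne_zero ?_ (by exact_mod_cast hn.ne')
          intro h; apply hk; omega)
        have : (fun x : ℝ => Real.cos (k * n * x) * Real.cos (n * x))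
            = fun x : ℝ => (1 / 2) * Real.cos ((((k : ℤ) + 1) * n : ℤ) * x)
              + (1 / 2) * Real.cos ((((k : ℤ) - 1) * n : ℤ) * x) := by
          ext x
          push_cast
          rw [show ((k : ℝ) + 1) * n * x = k * n * x + n * x by ring,
            show ((k : ℝ) - 1) * n * x = k * n * x - n * x by ring, Real.cos_add, Real.cos_sub]
          ring
        rw [this, intervalIntegral.integral_add (by apply Continuous.intervalIntegrable; fun_prop)
          (by apply Continuous.intervalIntegrable; fun_prop),
          intervalIntegral.integral_const_mul, intervalIntegral.integral_const_mul, e1, e2]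
        simp
      have hc := cos_mem_cosSpan n k
      refine ⟨(1 / (1 - (k : ℝ) ^ 2)) • (fun x : ℝ => Real.cos (k * n * x))
          + (0 : ℝ) • (fun x : ℝ => Real.cos (k * n * x)),
        add_mem (Submodule.smul_mem _ _ hc) (Submodule.smul_mem _ _ hc), 0,
        hint hc hc _ _ hi hi, fun x => ?_⟩
      rw [deriv_deriv_add_smul (contDiff_of_mem_cosSpan hc) (contDiff_of_mem_cosSpan hc),
        deriv_deriv_cos_mul]
      unfold planeWaveEnergy
      simp only [Pi.add_apply, Pi.smul_apply, smul_eq_mul]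
      field_simp
      ring
  | zero => exact ⟨0, zero_mem _, 0, by simp, fun x => by simp [h0]⟩
  | add f g hfm hgm hf hg =>
    obtain ⟨u, hu, c, hu0, hu'⟩ := hf
    obtain ⟨v, hv, d, hv0, hv'⟩ := hg
    refine ⟨(1 : ℝ) • u + (1 : ℝ) • v, by simpa using add_mem hu hv, c + d,
      hint hu hv 1 1 hu0 hv0, fun x => ?_⟩
    rw [deriv_deriv_add_smul (contDiff_of_mem_cosSpan hu) (contDiff_of_mem_cosSpan hv)]
    have h1 := hu' x
    have h2 := hv' x
    simp only [Pi.add_apply, Pi.smul_apply, smul_eq_mul]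
    linear_combination h1 + h2
  | smul a f hfm hf =>
    obtain ⟨u, hu, c, hu0, hu'⟩ := hf
    refine ⟨a • u + (0 : ℝ) • u, by simpa using Submodule.smul_mem _ a hu, a * c,
      hint hu hu a 0 hu0 hu0, fun x => ?_⟩
    rw [deriv_deriv_add_smul (contDiff_of_mem_cosSpan hu) (contDiff_of_mem_cosSpan hu)]
    have h1 := hu' x
    simp only [Pi.add_apply, Pi.smul_apply, smul_eq_mul]
    linear_combination a * h1

/-- The data of one order: wave function, potential, energy. -/
abbrev OrderData (n : ℕ) : Type := cosSpan n × cosSpan n × ℝ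

theorem exists_next {n : ℕ} (hn : 0 < n) (m : ℕ) (h : ℕ → OrderData n) :
    ∃ p : OrderData n,
      (∫ x in (0 : ℝ)..(2 * π), p.2.1.1 x = 0) ∧
      (∫ x in (0 : ℝ)..(2 * π), p.1.1 x * Real.cos (n * x) = 0) ∧
      (∀ x, 1 / (2 * planeWaveEnergy n) * deriv (deriv p.2.1.1) x
        = 8 * (densityOrder (fun j => (h j).1.1) m x
          - cosmologicalOrder (fun j => (h j).1.1) m)) ∧
      (∀ x, 1 / (2 * planeWaveEnergy n) * deriv (deriv p.1.1) x + p.1.1 x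
        = (∑ j ∈ Finset.Ico 1 m, (h (m - j)).1.1 x * ((h j).2.1.1 x - (h j).2.2))
          + Real.cos (n * x) * (p.2.1.1 x - p.2.2)) := by
  have hone : (fun x : ℝ => Real.cos (n * x)) ∈ cosSpan n := by
    simpa using cos_mem_cosSpan n 1
  have hconst : ∀ a : ℝ, (fun _ : ℝ => a) ∈ cosSpan n := by
    intro a
    have := (cosSpan n).smul_mem a (cos_mem_cosSpan n 0)
    convert this using 1
    ext x
    simp
  have hd : densityOrder (fun j => (h j).1.1) m ∈ cosSpan n := by
    have : densityOrder (fun j => (h j).1.1) m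
        = ∑ j ∈ Finset.Icc 1 m, (h (m - j)).1.1 * (h (j - 1)).1.1 := by
      ext x; simp [densityOrder, Finset.sum_apply]
    rw [this]
    exact sum_mem fun j _ => mul_mem_cosSpan (h (m - j)).1.2 (h (j - 1)).1.2
  obtain ⟨v, hv, hv0, hv'⟩ := exists_poisson hn hd
  have hv8 : (8 : ℝ) • v + (0 : ℝ) • v ∈ cosSpan n := by
    simpa using Submodule.smul_mem _ (8 : ℝ) hv
  have hg : (∑ j ∈ Finset.Ico 1 m, (h (m - j)).1.1 * ((h j).2.1.1 - fun _ => (h j).2.2))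
      + (fun x : ℝ => Real.cos (n * x)) * ((8 : ℝ) • v + (0 : ℝ) • v) ∈ cosSpan n :=
    add_mem (sum_mem fun j _ => mul_mem_cosSpan (h (m - j)).1.2 (sub_mem (h j).2.1.2 (hconst _)))
      (mul_mem_cosSpan hone hv8)
  obtain ⟨u, hu, c, hu0, hu'⟩ := exists_schrodinger hn hg
  refine ⟨(⟨u, hu⟩, ⟨_, hv8⟩, c), ?_, hu0, fun x => ?_, fun x => ?_⟩
  · rw [integral_add_smul_of_mem_cosSpan hv hv, hv0]; simp
  · rw [deriv_deriv_add_smul (contDiff_of_mem_cosSpan hv) (contDiff_of_mem_cosSpan hv)]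
    have := hv' x
    unfold cosmologicalOrder
    linear_combination 8 * this
  · rw [hu' x]
    simp only [Pi.add_apply, Finset.sum_apply, Pi.mul_apply, Pi.sub_apply]
    ring

/-- The background expansion exists for every positive wave number. -/
theorem exists_isBackgroundExpansion {n : ℕ} (hn : 0 < n) :
    ∃ (Ψ V : ℕ → ℝ → ℝ) (E : ℕ → ℝ), IsBackgroundExpansion n Ψ V E := by
  have hone : (fun x : ℝ => Real.cos (n * x)) ∈ cosSpan n := by
    simpa using cos_mem_cosSpan n 1
  choose next h1 h2 h3 h4 using fun m h => exists_next (n := n) hn m h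
  let z : OrderData n := (⟨_, hone⟩, 0, 1)
  let F : (m : ℕ) → ((j : ℕ) → j < m → OrderData n) → OrderData n := fun m prev =>
    if m = 0 then z else next m fun j => if hj : j < m then prev j hj else z
  let s : ℕ → OrderData n := fun m => Nat.strongRec (motive := fun _ => OrderData n) F m
  have hs : ∀ m, s m = if m = 0 then z else next m fun j => if j < m then s j else z := by
    intro m
    change Nat.strongRec (motive := fun _ => OrderData n) F m = _
    rw [Nat.strongRec_eq]
    simp only [F, s, dite_eq_ite]
  have hs0 : s 0 = z := by rw [hs]; simp
  have hsm : ∀ m, 1 ≤ m → s m = next m fun j => if j < m then s j else z := by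
    intro m hm
    rw [hs]; simp [show m ≠ 0 by omega]
  have hdens : ∀ m, densityOrder (fun j => (if j < m then s j else z : OrderData n).1.1) m
      = densityOrder (fun j => (s j).1.1) m := by
    intro m
    ext x
    unfold densityOrder
    refine Finset.sum_congr rfl fun j hj => ?_
    rw [Finset.mem_Icc] at hj
    simp only [if_pos (show m - j < m by omega), if_pos (show j - 1 < m by omega)]
  refine ⟨fun m => (s m).1.1, fun m => (s m).2.1.1, fun m => (s m).2.2, ?_⟩
  refine
    { wave_zero := fun x => by simp [hs0, z]
      potential_zero := fun x => by simp [hs0, z]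
      energy_zero := by simp [hs0, z]
      wave_contDiff := fun m => contDiff_of_mem_cosSpan (s m).1.2
      potential_contDiff := fun m => contDiff_of_mem_cosSpan (s m).2.1.2
      wave_periodic := fun m => periodic_of_mem_cosSpan (s m).1.2
      potential_periodic := fun m => periodic_of_mem_cosSpan (s m).2.1.2
      potential_mean := fun m => ?_
      schrodinger := fun m hm x => ?_
      poisson := fun m hm x => ?_
      wave_even := fun m => even_of_mem_cosSpan (s m).1.2
      wave_orthogonal := fun m hm => ?_ }
  · rcases Nat.eq_zero_or_pos m with rfl | hm
    · simp [hs0, z]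
    · simp only [hsm m hm]; exact h1 m _
  · have := h4 m (fun j => if j < m then s j else z) x
    rw [← hsm m hm] at this
    rw [this, ← Finset.Ico_insert_right hm, Finset.sum_insert (by simp), add_comm]
    congr 1
    · simp [hs0, z]
    · refine Finset.sum_congr rfl fun j hj => ?_
      rw [Finset.mem_Ico] at hj
      simp only [if_pos (show m - j < m by omega), if_pos hj.2]
  · have := h3 m (fun j => if j < m then s j else z) x
    rw [← hsm m hm] at this
    rw [this]
    unfold cosmologicalOrder
    rw [hdens]
  · have := h2 m (fun j => if j < m then s j else z)
    rw [← hsm m hm] at this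
    simpa [hs0, z] using this

/-! ### The root test -/

/-! Symmetry puts a node at each midpoint; a continuity argument in the density parameter `s`, run
from `0` to `ρ`, excludes all others.

By induction on the order, every `Ψ m` is odd and every `V m` even under the reflection `x ↦ π / n -
x` (`wave_and_potential_reflect`). Hence the sum vanishes at `π / (2n)` and, being even, changes
sign under translation by `π / n`. It remains to show positivity on `[0, π / (2n))`.

Inside the radius of convergence the orders are bounded geometrically, and the order equations carry
such bounds over to the derivatives. The sum therefore solves `ψ'' = n² (V - E) ψ` with a bounded
coefficient. A double zero would force `ψ = 0`, but orthogonality gives `∫ ψ cos (n x) = π`; so all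
zeros are simple for every `s ∈ [0, ρ]` (`backgroundWaveDeriv_ne_zero`). Zeros thus cannot be
created or merge as `s` grows, nor enter at `0`, where `ψ' = 0`, nor split off from the fixed simple
zero `π / (2n)`. Positivity of `cos (n x)` at `s = 0` then persists (`pos_on_Ico_of_simple_zeros`).
-/

theorem exists_le_geometric_of_rootRate_lt {a : ℕ → ℝ≥0∞} {q : NNReal} (hq : 0 < q)
    (h : rootRate a < q) : ∃ C : ℝ, 0 ≤ C ∧ ∀ m, (a m).toReal ≤ C * (q : ℝ) ^ m := by
  have hev : ∀ᶠ m in atTop, (a m).toReal ≤ (q : ℝ) ^ m := by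
    filter_upwards [eventually_lt_of_limsup_lt h, eventually_ge_atTop 1] with m hm hm1
    have h1 : a m ≤ ((q ^ m : NNReal) : ℝ≥0∞) := by
      rw [← ENNReal.rpow_inv_natCast_pow (n := m) (by omega) (a m), ENNReal.coe_pow]
      rw [one_div] at hm
      gcongr
    simpa using ENNReal.toReal_mono ENNReal.coe_ne_top h1
  have hO : (fun m => (a m).toReal) =O[atTop] fun m => (q : ℝ) ^ m := by
    refine Asymptotics.IsBigO.of_bound 1 ?_
    filter_upwards [hev] with m hm
    rw [Real.norm_of_nonneg ENNReal.toReal_nonneg, Real.norm_of_nonneg (by positivity), one_mul]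
    exact hm
  -- The finitely many orders before the eventual bound are absorbed into `C`; this is possible
  -- because `q ^ m` never vanishes.
  obtain ⟨C, hC, hb⟩ := Asymptotics.bound_of_isBigO_nat_atTop hO
  refine ⟨C, hC.le, fun m => ?_⟩
  have hq' : (0 : ℝ) < q := hq
  have := hb (x := m) (by positivity)
  rwa [Real.norm_of_nonneg ENNReal.toReal_nonneg, Real.norm_of_nonneg (by positivity)] at this

/-- Periodicity moves the point into `[0, 2π]`; compactness makes the supremum finite, so `toReal`
does not collapse it to `0`. -/
theorem abs_le_maxAbs_toReal {f : ℝ → ℝ} (hf : Continuous f) (hp : ∀ x, f (x + 2 * π) = f x)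
    (x : ℝ) : |f x| ≤ (maxAbs f).toReal := by
  obtain ⟨y, hy, hxy⟩ := Function.Periodic.exists_mem_Ico₀ (f := f) hp Real.two_pi_pos x
  obtain ⟨B, hB⟩ := (isCompact_Icc (a := (0 : ℝ)) (b := 2 * π)).exists_bound_of_continuousOn
    hf.continuousOn
  have hfin : maxAbs f ≠ ⊤ := by
    refine ne_top_of_le_ne_top (ENNReal.ofReal_ne_top (r := B)) (iSup₂_le fun z hz => ?_)
    rw [← ofReal_norm]
    exact ENNReal.ofReal_le_ofReal (hB z hz)
  have hle : ‖f y‖ₑ ≤ maxAbs f :=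
    le_iSup₂ (f := fun z (_ : z ∈ Icc (0 : ℝ) (2 * π)) => ‖f z‖ₑ) y (Ico_subset_Icc_self hy)
  have := ENNReal.toReal_mono hfin hle
  rw [hxy]
  simpa using this

theorem IsBackgroundExpansion.exists_geometric_bound {n : ℕ} {Ψ V : ℕ → ℝ → ℝ} {E : ℕ → ℝ}
    (hB : IsBackgroundExpansion n Ψ V E) {ρ : ℝ} (hρ0 : 0 ≤ ρ)
    (hρ : ENNReal.ofReal ρ < backgroundRadius Ψ V E) :
    ∃ C q : ℝ, 0 ≤ C ∧ 0 ≤ q ∧ ρ * q < 1 ∧ ∀ m, |E m| ≤ C * q ^ m ∧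
      ∀ x, |Ψ m x| ≤ C * q ^ m ∧ |V m x| ≤ C * q ^ m := by
  unfold backgroundRadius at hρ
  rw [ENNReal.lt_inv_iff_lt_inv] at hρ
  -- A common ratio strictly between all three growth rates and `1 / ρ` (read as `⊤` when `ρ = 0`).
  obtain ⟨q, hq1, hq2⟩ := ENNReal.lt_iff_exists_nnreal_btwn.1 hρ
  have hq0 : 0 < q := by
    have := (zero_le).trans_lt hq1
    exact_mod_cast this
  rw [max_lt_iff, max_lt_iff] at hq1
  obtain ⟨C₁, hC₁, h₁⟩ := exists_le_geometric_of_rootRate_lt hq0 hq1.1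
  obtain ⟨C₂, hC₂, h₂⟩ := exists_le_geometric_of_rootRate_lt hq0 hq1.2.1
  obtain ⟨C₃, hC₃, h₃⟩ := exists_le_geometric_of_rootRate_lt hq0 hq1.2.2
  have hqn : ∀ m, (0 : ℝ) ≤ (q : ℝ) ^ m := fun m => by positivity
  refine ⟨C₁ + C₂ + C₃, q, by positivity, q.2, ?_, fun m => ⟨?_, fun x => ⟨?_, ?_⟩⟩⟩
  · rw [← ENNReal.lt_inv_iff_lt_inv] at hq2
    rcases hρ0.eq_or_lt with rfl | hpos
    · simp
    · rw [← ENNReal.coe_inv hq0.ne', ← ENNReal.ofReal_coe_nnreal,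
        ENNReal.ofReal_lt_ofReal_iff (by simpa using hq0)] at hq2
      have hq' : (0 : ℝ) < q := hq0
      have := mul_lt_mul_of_pos_right hq2 hq'
      rwa [NNReal.coe_inv, inv_mul_cancel₀ hq'.ne'] at this
  · have := h₁ m
    simp only [toReal_enorm, Real.norm_eq_abs] at this
    nlinarith [mul_nonneg hC₂ (hqn m), mul_nonneg hC₃ (hqn m)]
  · have := (abs_le_maxAbs_toReal (hB.wave_contDiff m).continuous (hB.wave_periodic m) x).trans
      (h₂ m)
    nlinarith [mul_nonneg hC₁ (hqn m), mul_nonneg hC₃ (hqn m)]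
  · have := (abs_le_maxAbs_toReal (hB.potential_contDiff m).continuous
      (hB.potential_periodic m) x).trans (h₃ m)
    nlinarith [mul_nonneg hC₁ (hqn m), mul_nonneg hC₂ (hqn m)]

/-! ### Reflection symmetry of the orders -/

theorem hasDerivAt_of_contDiff_two {f : ℝ → ℝ} (hf : ContDiff ℝ 2 f) (x : ℝ) :
    HasDerivAt f (deriv f x) x :=
  (hf.differentiable (by norm_num) x).hasDerivAt

theorem hasDerivAt_deriv_of_contDiff_two {f : ℝ → ℝ} (hf : ContDiff ℝ 2 f) (x : ℝ) :
    HasDerivAt (deriv f) (deriv (deriv f) x) x := by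
  have := hf.differentiable_iteratedDeriv 1 (by norm_num)
  rw [iteratedDeriv_one] at this
  exact (this x).hasDerivAt

theorem exists_eq_cos_add_sin {w : ℝ} (hw : w ≠ 0) {f : ℝ → ℝ} (hf : ContDiff ℝ 2 f)
    (h : ∀ x, deriv (deriv f) x = -w ^ 2 * f x) :
    ∃ a b, ∀ x, f x = a * Real.cos (w * x) + b * Real.sin (w * x) := by
  have hc : ∀ x, HasDerivAt (fun x => Real.cos (w * x)) (-Real.sin (w * x) * w) x := fun x => by
    simpa using ((hasDerivAt_id x).const_mul w).cos
  have hs : ∀ x, HasDerivAt (fun x => Real.sin (w * x)) (Real.cos (w * x) * w) x := fun x => by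
    simpa using ((hasDerivAt_id x).const_mul w).sin
  have h0 := hasDerivAt_of_contDiff_two hf
  have h1 := hasDerivAt_deriv_of_contDiff_two hf
  -- The vector `(w f, f')` rotates with angular speed `w`; its coordinates in the co-rotating frame
  -- are the two first integrals `hA` and `hD`.
  have hA : ∀ x, HasDerivAt (fun x => w * f x * Real.cos (w * x) - deriv f x * Real.sin (w * x))
      0 x := fun x => by
    refine ((((h0 x).const_mul w).mul (hc x)).sub ((h1 x).mul (hs x))).congr_deriv ?_
    rw [h x]; ring
  have hD : ∀ x, HasDerivAt (fun x => w * f x * Real.sin (w * x) + deriv f x * Real.cos (w * x))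
      0 x := fun x => by
    refine ((((h0 x).const_mul w).mul (hs x)).add ((h1 x).mul (hc x))).congr_deriv ?_
    rw [h x]; ring
  have hA' := fun x => is_const_of_deriv_eq_zero (fun x => (hA x).differentiableAt)
    (fun x => (hA x).deriv) x 0
  have hD' := fun x => is_const_of_deriv_eq_zero (fun x => (hD x).differentiableAt)
    (fun x => (hD x).deriv) x 0
  refine ⟨f 0, deriv f 0 / w, fun x => ?_⟩
  have e1 := hA' x
  have e2 := hD' x
  simp only [mul_zero, Real.cos_zero, Real.sin_zero, mul_one, sub_zero, zero_add] at e1 e2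
  field_simp
  linear_combination Real.cos (w * x) * e1 + Real.sin (w * x) * e2
    - w * f x * Real.sin_sq_add_cos_sq (w * x)

theorem integral_comp_const_sub_of_periodic {g : ℝ → ℝ} (hg : Function.Periodic g (2 * π))
    (a : ℝ) : ∫ x in (0 : ℝ)..(2 * π), g (a - x) = ∫ x in (0 : ℝ)..(2 * π), g x := by
  rw [intervalIntegral.integral_comp_sub_left]
  have := hg.intervalIntegral_add_eq (a - 2 * π) 0
  simpa using this

theorem integral_eq_zero_of_odd_of_periodic {g : ℝ → ℝ} (hg : Function.Periodic g (2 * π))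
    (ho : ∀ x, g (-x) = -g x) : ∫ x in (0 : ℝ)..(2 * π), g x = 0 := by
  have h := integral_comp_const_sub_of_periodic hg 0
  simp only [zero_sub, ho, intervalIntegral.integral_neg] at h
  linarith

theorem integral_sin_sq_nat_mul {n : ℕ} (hn : 0 < n) :
    ∫ x in (0 : ℝ)..(2 * π), Real.sin (n * x) ^ 2 = π := by
  have hn' : (n : ℝ) ≠ 0 := by positivity
  rw [intervalIntegral.integral_comp_mul_left (f := fun x => Real.sin x ^ 2) hn', integral_sin_sq]
  have := Real.sin_nat_mul_pi (2 * n)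
  push_cast at this
  rw [show (n : ℝ) * (2 * π) = 2 * n * π by ring, this]
  simp
  field_simp

theorem integral_cos_sq_nat_mul {n : ℕ} (hn : 0 < n) :
    ∫ x in (0 : ℝ)..(2 * π), Real.cos (n * x) ^ 2 = π := by
  have hn' : (n : ℝ) ≠ 0 := by positivity
  rw [intervalIntegral.integral_comp_mul_left (f := fun x => Real.cos x ^ 2) hn', integral_cos_sq]
  have := Real.sin_nat_mul_pi (2 * n)
  push_cast at this
  rw [show (n : ℝ) * (2 * π) = 2 * n * π by ring, this]
  simp
  field_simp

theorem deriv_deriv_comp_const_sub (f : ℝ → ℝ) (a x : ℝ) :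
    deriv (deriv fun x => f (a - x)) x = deriv (deriv f) (a - x) := by
  have h : deriv (fun x => f (a - x)) = fun x => -deriv f (a - x) :=
    funext fun y => deriv_comp_const_sub f a y
  rw [h, deriv.fun_neg, deriv_comp_const_sub, neg_neg]

theorem periodic_nat_mul_two_pi_sin (n : ℕ) : Function.Periodic (fun x => Real.sin (n * x))
    (2 * π) := fun x => by
  simp only [mul_add]
  exact Real.sin_add_nat_mul_two_pi _ n

/-- A periodic function whose second derivative is symmetric about `a / 2` is itself
symmetric. -/
theorem comp_const_sub_eq_of_deriv_deriv {v : ℝ → ℝ} {a : ℝ} (hv : ContDiff ℝ 2 v)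
    (hp : Function.Periodic v (2 * π))
    (h : ∀ x, deriv (deriv v) (a - x) = deriv (deriv v) x) (x : ℝ) : v (a - x) = v x := by
  have hr : ContDiff ℝ 2 fun x => v (a - x) := by fun_prop
  -- `f'' = 0`, so `f` is affine; periodicity kills the slope `b`, and the mean of `f` is zero
  -- because the reflection preserves integrals over a period.
  set f : ℝ → ℝ := fun x => v (a - x) - v x with hf
  have hd0 : ∀ x, HasDerivAt f (deriv (fun x => v (a - x)) x - deriv v x) x := fun x =>
    (hasDerivAt_of_contDiff_two hr x).sub (hasDerivAt_of_contDiff_two hv x)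
  have hd1 : ∀ x, HasDerivAt (fun x => deriv (fun x => v (a - x)) x - deriv v x) 0 x := fun x => by
    refine ((hasDerivAt_deriv_of_contDiff_two hr x).sub
      (hasDerivAt_deriv_of_contDiff_two hv x)).congr_deriv ?_
    rw [deriv_deriv_comp_const_sub, h, sub_self]
  have hfp : Function.Periodic f (2 * π) := fun x => by
    simp only [hf, hp x]
    rw [← hp (a - (x + 2 * π))]
    congr 2; ring
  obtain ⟨b, hb⟩ : ∃ b, ∀ x, deriv (fun x => v (a - x)) x - deriv v x = b :=
    ⟨_, fun x => is_const_of_deriv_eq_zero (fun x => (hd1 x).differentiableAt)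
      (fun x => (hd1 x).deriv) x 0⟩
  have hlin : ∀ x, f x - b * x = f 0 - b * 0 := fun x => by
    have hd : ∀ x, HasDerivAt (fun x => f x - b * x) 0 x := fun x => by
      refine ((hd0 x).sub ((hasDerivAt_id x).const_mul b)).congr_deriv ?_
      rw [hb]; simp
    exact is_const_of_deriv_eq_zero (fun x => (hd x).differentiableAt) (fun x => (hd x).deriv) x 0
  have hb0 : b = 0 := by
    have h1 := hlin (2 * π)
    have h2 := hfp 0
    rw [zero_add] at h2
    rw [h2] at h1
    have : b * (2 * π) = 0 := by linarith
    simpa [Real.pi_ne_zero] using this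
  have hconst : ∀ x, f x = f 0 := fun x => by have := hlin x; rw [hb0] at this; linarith
  have hint : ∫ x in (0 : ℝ)..(2 * π), f x = 0 := by
    rw [hf, intervalIntegral.integral_sub (hr.continuous.intervalIntegrable _ _)
      (hv.continuous.intervalIntegrable _ _), integral_comp_const_sub_of_periodic hp, sub_self]
  have h0 : f 0 = 0 := by
    rw [intervalIntegral.integral_congr (g := fun _ => f 0) fun x _ => hconst x,
      intervalIntegral.integral_const, sub_zero, smul_eq_mul] at hint
    simpa [Real.pi_ne_zero] using hint
  have := hconst x
  rw [h0] at this
  exact sub_eq_zero.1 this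

/-- An even periodic function for which `u'' + n² u` is antisymmetric about `π / (2n)` is itself
antisymmetric. -/
theorem comp_const_sub_eq_neg_of_deriv_deriv {n : ℕ} (hn : 0 < n) {u : ℝ → ℝ}
    (hu : ContDiff ℝ 2 u) (hp : Function.Periodic u (2 * π)) (he : ∀ x, u (-x) = u x)
    (h : ∀ x, deriv (deriv u) (π / n - x) + (n : ℝ) ^ 2 * u (π / n - x)
      = -(deriv (deriv u) x + (n : ℝ) ^ 2 * u x)) (x : ℝ) : u (π / n - x) = -u x := by
  have hn' : (n : ℝ) ≠ 0 := by positivity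
  have hr : ContDiff ℝ 2 fun x => u (π / n - x) := by fun_prop
  have hsum : ContDiff ℝ 2 fun x => u (π / n - x) + u x := hr.add hu
  have hdd : ∀ x, deriv (deriv fun x => u (π / n - x) + u x) x
      = -(n : ℝ) ^ 2 * (u (π / n - x) + u x) := fun x => by
    have := deriv_deriv_add_smul hr hu 1 1 x
    rw [one_smul, one_smul, one_mul, one_mul, deriv_deriv_comp_const_sub] at this
    rw [show (fun x => u (π / n - x) + u x) = (fun x => u (π / n - x)) + u from rfl, this]
    linear_combination h x
  obtain ⟨a, b, hab⟩ := exists_eq_cos_add_sin hn' hsum hdd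
  have hsin : ∀ x, Real.sin (n * (π / n - x)) = Real.sin (n * x) := fun x => by
    rw [show n * (π / n - x) = π - n * x by field_simp, Real.sin_pi_sub]
  have hcos : ∀ x, Real.cos (n * (π / n - x)) = -Real.cos (n * x) := fun x => by
    rw [show n * (π / n - x) = π - n * x by field_simp, Real.cos_pi_sub]
  -- The left side of `hab` is symmetric about `π / (2n)` while the cosine is antisymmetric;
  -- comparing `0` with `π / n` gives `a = -a`.
  have ha : a = 0 := by
    have h0 := hab 0
    have h1 := hab (π / n - 0)
    rw [hsin, hcos, sub_zero, sub_self] at h1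
    rw [sub_zero] at h0
    simp only [mul_zero, Real.cos_zero, Real.sin_zero] at h0 h1
    linarith
  -- The sine mode is itself symmetric about `π / (2n)`, so evenness of `u` must remove it: `u` and
  -- its reflection are both orthogonal to `sin (n x)`.
  set g : ℝ → ℝ := fun x => u x * Real.sin (n * x) with hg
  have hgp : Function.Periodic g (2 * π) := hp.mul (periodic_nat_mul_two_pi_sin n)
  have hg0 : ∫ x in (0 : ℝ)..(2 * π), g x = 0 :=
    integral_eq_zero_of_odd_of_periodic hgp fun x => by simp [hg, he]
  have hgc : Continuous g := by have := hu.continuous; fun_prop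
  have hgr : Continuous fun x => g (π / n - x) := by fun_prop
  have hint : ∫ x in (0 : ℝ)..(2 * π), b * Real.sin (n * x) ^ 2 = 0 := by
    rw [intervalIntegral.integral_congr (g := fun x => g (π / n - x) + g x) fun x _ => ?_,
      intervalIntegral.integral_add (hgr.intervalIntegrable _ _)
      (hgc.intervalIntegrable _ _), integral_comp_const_sub_of_periodic hgp, hg0, add_zero]
    have := hab x
    rw [ha] at this
    simp only [hg, hsin]
    linear_combination -Real.sin (n * x) * this
  rw [intervalIntegral.integral_const_mul, integral_sin_sq_nat_mul hn] at hint
  have hb : b = 0 := by simpa [Real.pi_ne_zero] using hint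
  have := hab x
  rw [ha, hb] at this
  linarith

namespace IsBackgroundExpansion

variable {n : ℕ} {Ψ V : ℕ → ℝ → ℝ} {E : ℕ → ℝ}

/-- The density at order `m` is a sum of products of two antisymmetric waves of lower order, hence
symmetric, and so is `V m`. The Schrödinger source then has only antisymmetric terms. The potential
comes first because that source contains `V m` itself. -/
theorem wave_and_potential_reflect (hB : IsBackgroundExpansion n Ψ V E) (hn : 0 < n) (m : ℕ) :
    (∀ x, Ψ m (π / n - x) = -Ψ m x) ∧ ∀ x, V m (π / n - x) = V m x := by
  have hn' : (n : ℝ) ≠ 0 := by positivity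
  induction m using Nat.strong_induction_on with
  | _ m ih =>
  rcases Nat.eq_zero_or_pos m with rfl | hm
  · refine ⟨fun x => ?_, fun x => by simp [hB.potential_zero]⟩
    rw [hB.wave_zero, hB.wave_zero, show n * (π / n - x) = π - n * x by field_simp,
      Real.cos_pi_sub]
  have hV : ∀ x, V m (π / n - x) = V m x := by
    refine comp_const_sub_eq_of_deriv_deriv (hB.potential_contDiff m) (hB.potential_periodic m)
      fun x => ?_
    have h1 := hB.poisson m hm (π / n - x)
    have h2 := hB.poisson m hm x
    have hd : densityOrder Ψ m (π / n - x) = densityOrder Ψ m x := by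
      refine Finset.sum_congr rfl fun j hj => ?_
      rw [Finset.mem_Icc] at hj
      rw [(ih (m - j) (by omega)).1, (ih (j - 1) (by omega)).1, neg_mul_neg]
    rw [hd, ← h2] at h1
    unfold planeWaveEnergy at h1
    exact mul_left_cancel₀ (by positivity) h1
  refine ⟨comp_const_sub_eq_neg_of_deriv_deriv hn (hB.wave_contDiff m) (hB.wave_periodic m)
    (hB.wave_even m) fun x => ?_, hV⟩
  have h1 := hB.schrodinger m hm (π / n - x)
  have h2 := hB.schrodinger m hm x
  have hs : ∑ j ∈ Finset.Icc 1 m, Ψ (m - j) (π / n - x) * (V j (π / n - x) - E j)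
      = -∑ j ∈ Finset.Icc 1 m, Ψ (m - j) x * (V j x - E j) := by
    rw [← Finset.sum_neg_distrib]
    refine Finset.sum_congr rfl fun j hj => ?_
    rw [Finset.mem_Icc] at hj
    have hVj : V j (π / n - x) = V j x := by
      rcases hj.2.eq_or_lt with rfl | hlt
      · exact hV x
      · exact (ih j hlt).2 x
    rw [hVj, (ih (m - j) (by omega)).1, neg_mul]
  rw [hs, ← h2] at h1
  unfold planeWaveEnergy at h1
  refine mul_left_cancel₀ (a := 1 / (2 * ((n : ℝ) ^ 2 / 2))) (by positivity) ?_
  have h3 : 1 / (2 * ((n : ℝ) ^ 2 / 2)) * (n : ℝ) ^ 2 = 1 := by field_simp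
  linear_combination h1 + (Ψ m (π / n - x) + Ψ m x) * h3

end IsBackgroundExpansion

/-! ### The continuity method -/

theorem HasDerivAt.eventually_lt_nhdsGT {f : ℝ → ℝ} {f' x : ℝ} (h : HasDerivAt f f' x)
    (hf : f' < 0) : ∀ᶠ y in nhdsWithin x (Ioi x), f y < f x := by
  have hs := (hasDerivAt_iff_tendsto_slope.1 h).eventually_lt_const hf
  have hle : nhdsWithin x (Ioi x) ≤ nhdsWithin x {x}ᶜ :=
    nhdsWithin_mono x fun y hy => ne_of_gt hy
  filter_upwards [hle hs, self_mem_nhdsWithin] with y hy hxy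
  have hxy' : 0 < y - x := sub_pos.2 hxy
  rw [slope_def_field, div_neg_iff] at hy
  rcases hy with hy | hy <;> linarith [hy.1, hy.2]

theorem HasDerivAt.eventually_lt_nhdsLT {f : ℝ → ℝ} {f' x : ℝ} (h : HasDerivAt f f' x)
    (hf : 0 < f') : ∀ᶠ y in nhdsWithin x (Iio x), f y < f x := by
  have hs := (hasDerivAt_iff_tendsto_slope.1 h).eventually_const_lt hf
  have hle : nhdsWithin x (Iio x) ≤ nhdsWithin x {x}ᶜ :=
    nhdsWithin_mono x fun y hy => ne_of_lt hy
  filter_upwards [hle hs, self_mem_nhdsWithin] with y hy hxy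
  have hxy' : y - x < 0 := sub_neg.2 hxy
  rw [slope_def_field, div_pos_iff] at hy
  rcases hy with hy | hy <;> linarith [hy.1, hy.2]

/-- At a negative minimum, necessarily left of `c`, the slope would be negative and smaller values
would occur to the right. The strict alternative `0 < f ∨ f' < 0` survives small perturbations,
unlike `0 ≤ f`. -/
theorem nonneg_of_forall_pos_or_deriv_neg {f f' : ℝ → ℝ} {c : ℝ}
    (hf : ∀ x, HasDerivAt f (f' x) x) (hc : f c = 0)
    (h : ∀ x ∈ Icc 0 c, 0 < f x ∨ f' x < 0) : ∀ x ∈ Icc 0 c, 0 ≤ f x := by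
  intro x hx
  have hcont : Continuous f := continuous_iff_continuousAt.2 fun x => (hf x).continuousAt
  obtain ⟨y, hy, hmin⟩ := isCompact_Icc.exists_isMinOn ⟨x, hx⟩ hcont.continuousOn
  refine le_trans ?_ (hmin hx)
  by_contra hneg
  rw [not_le] at hneg
  have hyc : y < c := lt_of_le_of_ne hy.2 fun e => by rw [e, hc] at hneg; exact lt_irrefl _ hneg
  have hd : f' y < 0 := (h y hy).resolve_left (not_lt.2 hneg.le)
  obtain ⟨z, hz, hzc⟩ := (((hf y).eventually_lt_nhdsGT hd).and (Ioo_mem_nhdsGT hyc)).exists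
  exact (not_lt.2 (hmin ⟨hy.1.trans hzc.1.le, hzc.2.le⟩)) hz

/-- A connected family of functions with only simple zeros, vanishing at `c` and critical at `0`,
stays positive on `[0, c)` if one member is nonnegative there. -/
theorem pos_on_Ico_of_simple_zeros {X : Type*} [TopologicalSpace X] [PreconnectedSpace X]
    {P D : X → ℝ → ℝ} {c : ℝ} (hP : Continuous fun z : X × ℝ => P z.1 z.2)
    (hD : Continuous fun z : X × ℝ => D z.1 z.2) (hPD : ∀ s x, HasDerivAt (P s) (D s x) x)
    (hc : ∀ s, P s c = 0) (h0 : ∀ s, D s 0 = 0) (hsimple : ∀ s x, P s x = 0 → D s x ≠ 0)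
    {s₀ : X} (hs₀ : ∀ x ∈ Icc 0 c, 0 ≤ P s₀ x) (s : X) : ∀ x ∈ Ico 0 c, 0 < P s x := by
  set T : Set X := {s | ∀ x ∈ Icc 0 c, 0 ≤ P s x} with hT
  -- A zero of a nonnegative member is simple and differs from `0`, where the slope vanishes; a
  -- positive slope would give negative values on its left.
  have hTS : ∀ s ∈ T, ∀ x ∈ Icc 0 c, 0 < P s x ∨ D s x < 0 := by
    intro s hs x hx
    rcases (hs x hx).lt_or_eq with hpos | hzero
    · exact Or.inl hpos
    · right
      have hne := hsimple s x hzero.symm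
      have hx0 : 0 < x := lt_of_le_of_ne hx.1 fun e => hne (by rw [← e]; exact h0 s)
      refine lt_of_le_of_ne ?_ hne
      by_contra hpos
      rw [not_le] at hpos
      obtain ⟨z, hz, hzx⟩ :=
        (((hPD s x).eventually_lt_nhdsLT hpos).and (Ioo_mem_nhdsLT hx0)).exists
      have := hs z ⟨hzx.1.le, hzx.2.le.trans hx.2⟩
      linarith
  have hclosed : IsClosed T := by
    simp only [hT, ofPred_forall]
    refine isClosed_iInter fun x => isClosed_iInter fun _ => isClosed_le continuous_const ?_
    exact hP.comp (continuous_id.prodMk continuous_const)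
  have hopen : IsOpen T := by
    refine isOpen_iff_mem_nhds.2 fun s hs => ?_
    -- The alternative is open in `(s, x)` jointly, so compactness of `[0, c]` provides a single
    -- neighbourhood of `s`.
    have hev : ∀ᶠ s' in nhds s, ∀ x ∈ Icc 0 c, 0 < P s' x ∨ D s' x < 0 := by
      refine isCompact_Icc.eventually_forall_of_forall_eventually fun x hx => ?_
      rcases hTS s hs x hx with h | h
      · exact ((hP.tendsto (s, x)).eventually_const_lt h).mono fun _ => Or.inl
      · exact ((hD.tendsto (s, x)).eventually_lt_const h).mono fun _ => Or.inr
    exact hev.mono fun s' hs' => nonneg_of_forall_pos_or_deriv_neg (hPD s') (hc s') hs'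
  have huniv : T = univ := IsClopen.eq_univ ⟨hclosed, hopen⟩ ⟨s₀, hs₀⟩
  have hsT : s ∈ T := huniv ▸ mem_univ s
  intro x hx
  -- A zero before `c` would have negative slope, hence negative values just to its right, still
  -- inside `[0, c]`.
  refine lt_of_le_of_ne (hsT x ⟨hx.1, hx.2.le⟩) fun hzero => ?_
  have hd : D s x < 0 := (hTS s hsT x ⟨hx.1, hx.2.le⟩).resolve_left hzero.not_lt
  obtain ⟨z, hz, hzc⟩ := (((hPD s x).eventually_lt_nhdsGT hd).and (Ioo_mem_nhdsGT hx.2)).exists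
  have := hsT z ⟨hx.1.trans hzc.1.le, hzc.2.le⟩
  linarith

/-- Uniqueness for the linear equation `u'' = q u` with a bounded coefficient. -/
theorem eq_zero_of_deriv_deriv_eq_mul {u u' q : ℝ → ℝ} {B : ℝ} (hu : ∀ x, HasDerivAt u (u' x) x)
    (hu' : ∀ x, HasDerivAt u' (q x * u x) x) (hq : ∀ x, |q x| ≤ B) {x₀ : ℝ} (h : u x₀ = 0)
    (h' : u' x₀ = 0) (x : ℝ) : u x = 0 := by
  have hB : 0 ≤ B := (abs_nonneg _).trans (hq 0)
  have hlip : ∀ t, LipschitzOnWith (Real.toNNReal (1 + B))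
      (fun p : ℝ × ℝ => (p.2, q t * p.1)) univ := fun t => by
    refine (LipschitzWith.of_dist_le_mul fun a b => ?_).lipschitzOnWith
    rw [Real.coe_toNNReal _ (by positivity), Prod.dist_eq, Prod.dist_eq]
    simp only [Real.dist_eq]
    rw [← mul_sub, abs_mul]
    have h1 := le_max_left |a.1 - b.1| |a.2 - b.2|
    have h2 := le_max_right |a.1 - b.1| |a.2 - b.2|
    have h3 := abs_nonneg (a.1 - b.1)
    have h4 := mul_le_mul (hq t) h1 h3 hB
    refine max_le ?_ ?_ <;> nlinarith
  have hz : ∀ t : ℝ, HasDerivAt (fun _ : ℝ => ((0, 0) : ℝ × ℝ)) (0, q t * 0) t := fun t => by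
    rw [mul_zero]; exact hasDerivAt_const t _
  have := ODE_solution_unique_univ (v := fun t (p : ℝ × ℝ) => (p.2, q t * p.1))
    (f := fun t => (u t, u' t)) (g := fun _ => (0, 0)) (t₀ := x₀) hlip
    (fun t => ⟨(hu t).prodMk (hu' t), mem_univ _⟩) (fun t => ⟨hz t, mem_univ _⟩) (by simp [h, h'])
  exact congrArg Prod.fst (congrFun this x)

/-! ### Summation of the expansion -/

/-- The common majorant for the wave and its derivatives; the factor `m + 1` counts the terms of the
Cauchy product in `Ψ m''`. -/
theorem summable_succ_mul_geometric {A θ : ℝ} (h0 : 0 ≤ θ) (h1 : θ < 1) :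
    Summable fun m : ℕ => A * ((m + 1) * θ ^ m) := by
  have hn : ‖θ‖ < 1 := by rwa [Real.norm_of_nonneg h0]
  have h := (summable_pow_mul_geometric_of_norm_lt_one 1 hn).add
    (summable_pow_mul_geometric_of_norm_lt_one 0 hn)
  refine (h.congr fun m => ?_).mul_left A
  ring

theorem norm_pow_mul_le {s ρ q A a : ℝ} {m : ℕ} (hs : s ∈ Icc 0 ρ)
    (ha : |a| ≤ A * ((m + 1) * q ^ m)) : ‖s ^ m * a‖ ≤ A * ((m + 1) * (ρ * q) ^ m) := by
  rw [norm_mul, Real.norm_of_nonneg (pow_nonneg hs.1 m), Real.norm_eq_abs, mul_pow]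
  calc s ^ m * |a| ≤ ρ ^ m * (A * ((m + 1) * q ^ m)) := by
        gcongr
        exacts [pow_nonneg (hs.1.trans hs.2) m, hs.1, hs.2]
    _ = _ := by ring

/-- The formal `x`-derivative of `backgroundWave`. -/
noncomputable def backgroundWaveDeriv (Ψ : ℕ → ℝ → ℝ) (ρ x : ℝ) : ℝ :=
  ∑' m : ℕ, ρ ^ m * deriv (Ψ m) x

namespace IsBackgroundExpansion

variable {n : ℕ} {Ψ V : ℕ → ℝ → ℝ} {E : ℕ → ℝ} {C q ρ s : ℝ}

/-- Since `V 0 = 0` and `E 0 = 1`, the term `-Ψ m` is the missing `j = 0` term, so the right side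
becomes a full Cauchy product, valid also at order zero. -/
theorem deriv_deriv_wave (hB : IsBackgroundExpansion n Ψ V E) (hn : 0 < n) (m : ℕ) (x : ℝ) :
    deriv (deriv (Ψ m)) x
      = n ^ 2 * ∑ p ∈ Finset.HasAntidiagonal.antidiagonal m, (V p.1 x - E p.1) * Ψ p.2 x := by
  have hn' : (n : ℝ) ≠ 0 := by positivity
  rw [Finset.Nat.sum_antidiagonal_eq_sum_range_succ (fun i j => (V i x - E i) * Ψ j x),
    Finset.sum_range_eq_add_Ico _ (Nat.succ_pos m)]
  rcases Nat.eq_zero_or_pos m with rfl | hm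
  · rw [show Ψ 0 = fun x => Real.cos (n * x) from funext hB.wave_zero, deriv_deriv_cos_mul]
    simp [hB.potential_zero, hB.energy_zero]
  · have h := hB.schrodinger m hm x
    have hI : Finset.Ico 1 m.succ = Finset.Icc 1 m := by ext; simp
    rw [hI, Finset.sum_congr rfl fun j _ => mul_comm (V j x - E j) (Ψ (m - j) x), ← h,
      hB.potential_zero, hB.energy_zero]
    unfold planeWaveEnergy
    field_simp
    simp

theorem deriv_wave_zero (hB : IsBackgroundExpansion n Ψ V E) (m : ℕ) : deriv (Ψ m) 0 = 0 := by
  have h := deriv_comp_neg (Ψ m) 0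
  rw [show (fun x => Ψ m (-x)) = Ψ m from funext (hB.wave_even m), neg_zero] at h
  linarith

theorem abs_wave_le (hC : 0 ≤ C) (hq : 0 ≤ q)
    (hb : ∀ m, |E m| ≤ C * q ^ m ∧ ∀ x, |Ψ m x| ≤ C * q ^ m ∧ |V m x| ≤ C * q ^ m)
    (m : ℕ) (x : ℝ) : |Ψ m x| ≤ C * ((m + 1) * q ^ m) := by
  refine ((hb m).2 x).1.trans (mul_le_mul_of_nonneg_left ?_ hC)
  exact le_mul_of_one_le_left (by positivity) (by linarith [(Nat.cast_nonneg m : (0 : ℝ) ≤ m)])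

theorem abs_potential_sub_energy_le
    (hb : ∀ m, |E m| ≤ C * q ^ m ∧ ∀ x, |Ψ m x| ≤ C * q ^ m ∧ |V m x| ≤ C * q ^ m)
    (m : ℕ) (x : ℝ) : |V m x - E m| ≤ 2 * C * q ^ m := by
  have h1 := abs_sub (V m x) (E m)
  have h2 := ((hb m).2 x).2
  have h3 := (hb m).1
  linarith

/-- The growth rates say nothing about derivatives; the order equation recovers their bounds from
those of `Ψ`, `V` and `E`. -/
theorem abs_deriv_deriv_wave_le (hB : IsBackgroundExpansion n Ψ V E) (hn : 0 < n) (hC : 0 ≤ C)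
    (hq : 0 ≤ q)
    (hb : ∀ m, |E m| ≤ C * q ^ m ∧ ∀ x, |Ψ m x| ≤ C * q ^ m ∧ |V m x| ≤ C * q ^ m)
    (m : ℕ) (x : ℝ) :
    |deriv (deriv (Ψ m)) x| ≤ n ^ 2 * (2 * C * C) * ((m + 1) * q ^ m) := by
  rw [hB.deriv_deriv_wave hn, abs_mul, abs_of_nonneg (by positivity : (0 : ℝ) ≤ (n : ℝ) ^ 2),
    mul_assoc]
  gcongr
  refine (Finset.abs_sum_le_sum_abs _ _).trans ((Finset.sum_le_card_nsmul _ _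
    (2 * C * C * q ^ m) fun p hp => ?_).trans (le_of_eq ?_))
  · rw [Finset.HasAntidiagonal.mem_antidiagonal] at hp
    rw [abs_mul, ← hp, pow_add]
    calc _ ≤ (2 * C * q ^ p.1) * (C * q ^ p.2) :=
          mul_le_mul (abs_potential_sub_energy_le hb _ x) ((hb _).2 x).1 (abs_nonneg _)
            (by positivity)
      _ = _ := by ring
  · rw [Finset.Nat.card_antidiagonal, nsmul_eq_mul]
    push_cast
    ring

/-- Mean value inequality from `0`, where evenness makes the derivative vanish; periodicity limits
the distance to `2π`, which makes the bound uniform on the line. -/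
theorem abs_deriv_wave_le (hB : IsBackgroundExpansion n Ψ V E) (hn : 0 < n) (hC : 0 ≤ C)
    (hq : 0 ≤ q)
    (hb : ∀ m, |E m| ≤ C * q ^ m ∧ ∀ x, |Ψ m x| ≤ C * q ^ m ∧ |V m x| ≤ C * q ^ m)
    (m : ℕ) (x : ℝ) :
    |deriv (Ψ m) x| ≤ n ^ 2 * (2 * C * C) * (2 * π) * ((m + 1) * q ^ m) := by
  have hp : Function.Periodic (deriv (Ψ m)) (2 * π) := fun y => by
    rw [← deriv_comp_add_const, show (fun x => Ψ m (x + 2 * π)) = Ψ m from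
      funext (hB.wave_periodic m)]
  obtain ⟨y, hy, hxy⟩ := hp.exists_mem_Ico₀ Real.two_pi_pos x
  have h := Convex.norm_image_sub_le_of_norm_deriv_le (f := deriv (Ψ m)) (x := 0) (y := y)
    (fun z _ => (hasDerivAt_deriv_of_contDiff_two (hB.wave_contDiff m) z).differentiableAt)
    (fun z _ => hB.abs_deriv_deriv_wave_le hn hC hq hb m z) convex_univ (mem_univ _) (mem_univ _)
  rw [hB.deriv_wave_zero, sub_zero, sub_zero, Real.norm_eq_abs, Real.norm_of_nonneg hy.1] at h
  rw [hxy]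
  refine h.trans ?_
  calc _ ≤ n ^ 2 * (2 * C * C) * ((m + 1) * q ^ m) * (2 * π) := by
        gcongr
        exact hy.2.le
    _ = _ := by ring

theorem summable_wave (hC : 0 ≤ C) (hq : 0 ≤ q) (hρ : ρ * q < 1)
    (hb : ∀ m, |E m| ≤ C * q ^ m ∧ ∀ x, |Ψ m x| ≤ C * q ^ m ∧ |V m x| ≤ C * q ^ m)
    (hs : s ∈ Icc 0 ρ) (x : ℝ) : Summable fun m => s ^ m * Ψ m x :=
  .of_norm_bounded (summable_succ_mul_geometric (mul_nonneg (hs.1.trans hs.2) hq) hρ)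
    fun m => norm_pow_mul_le hs (abs_wave_le hC hq hb m x)

theorem hasDerivAt_backgroundWave (hB : IsBackgroundExpansion n Ψ V E) (hn : 0 < n) (hC : 0 ≤ C)
    (hq : 0 ≤ q) (hρ : ρ * q < 1)
    (hb : ∀ m, |E m| ≤ C * q ^ m ∧ ∀ x, |Ψ m x| ≤ C * q ^ m ∧ |V m x| ≤ C * q ^ m)
    (hs : s ∈ Icc 0 ρ) (x : ℝ) :
    HasDerivAt (backgroundWave Ψ s) (backgroundWaveDeriv Ψ s x) x :=
  hasDerivAt_tsum (summable_succ_mul_geometric (mul_nonneg (hs.1.trans hs.2) hq) hρ)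
    (fun m y => (hasDerivAt_of_contDiff_two (hB.wave_contDiff m) y).const_mul (s ^ m))
    (fun m y => norm_pow_mul_le hs (hB.abs_deriv_wave_le hn hC hq hb m y))
    (summable_wave hC hq hρ hb hs 0) x

/-- The termwise second derivatives are Cauchy products, so they resum to the Schrödinger equation
at the finite parameter `s`. -/
theorem hasDerivAt_backgroundWaveDeriv (hB : IsBackgroundExpansion n Ψ V E) (hn : 0 < n)
    (hC : 0 ≤ C) (hq : 0 ≤ q) (hρ : ρ * q < 1)
    (hb : ∀ m, |E m| ≤ C * q ^ m ∧ ∀ x, |Ψ m x| ≤ C * q ^ m ∧ |V m x| ≤ C * q ^ m)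
    (hs : s ∈ Icc 0 ρ) (x : ℝ) :
    HasDerivAt (backgroundWaveDeriv Ψ s)
      (n ^ 2 * (∑' m, s ^ m * (V m x - E m)) * backgroundWave Ψ s x) x := by
  have hθ : 0 ≤ ρ * q := mul_nonneg (hs.1.trans hs.2) hq
  have hsW : Summable fun m => ‖s ^ m * (V m x - E m)‖ :=
    .of_nonneg_of_le (fun _ => norm_nonneg _) (fun m => norm_pow_mul_le hs
      ((abs_potential_sub_energy_le hb m x).trans (mul_le_mul_of_nonneg_left
        (le_mul_of_one_le_left (by positivity) (by linarith [(Nat.cast_nonneg m : (0 : ℝ) ≤ m)]))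
        (by positivity)))) (summable_succ_mul_geometric hθ hρ)
  have h := hasDerivAt_tsum (summable_succ_mul_geometric hθ hρ)
    (fun m y => (hasDerivAt_deriv_of_contDiff_two (hB.wave_contDiff m) y).const_mul (s ^ m))
    (fun m y => norm_pow_mul_le hs (hB.abs_deriv_deriv_wave_le hn hC hq hb m y))
    (y₀ := 0) (by simp [hB.deriv_wave_zero]) x
  refine h.congr_deriv ?_
  unfold backgroundWave
  rw [mul_assoc, tsum_mul_tsum_eq_tsum_sum_antidiagonal_of_summable_norm hsW
    (summable_wave hC hq hρ hb hs x).norm, ← tsum_mul_left]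
  refine tsum_congr fun m => ?_
  rw [hB.deriv_deriv_wave hn, mul_left_comm, Finset.mul_sum]
  congr 1
  refine Finset.sum_congr rfl fun p hp => ?_
  rw [Finset.HasAntidiagonal.mem_antidiagonal] at hp
  rw [← hp, pow_add]
  ring

/-- Only order zero contributes, by orthogonality. This certifies that the summed wave is not
identically zero. -/
theorem integral_backgroundWave_mul_cos (hB : IsBackgroundExpansion n Ψ V E) (hn : 0 < n)
    (hC : 0 ≤ C) (hq : 0 ≤ q) (hρ : ρ * q < 1)
    (hb : ∀ m, |E m| ≤ C * q ^ m ∧ ∀ x, |Ψ m x| ≤ C * q ^ m ∧ |V m x| ≤ C * q ^ m)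
    (hs : s ∈ Icc 0 ρ) :
    ∫ x in (0 : ℝ)..(2 * π), backgroundWave Ψ s x * Real.cos (n * x) = π := by
  have hsum := summable_succ_mul_geometric (A := C) (mul_nonneg (hs.1.trans hs.2) hq) hρ
  have h : HasSum (fun m : ℕ => ∫ x in (0 : ℝ)..(2 * π), s ^ m * Ψ m x * Real.cos (n * x))
      (∫ x in (0 : ℝ)..(2 * π), backgroundWave Ψ s x * Real.cos (n * x)) := by
    refine intervalIntegral.hasSum_integral_of_dominated_convergence
      (fun m _ => C * ((m + 1) * (ρ * q) ^ m)) (fun m => ?_) (fun m => ?_) ?_ ?_ ?_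
    · have := (hB.wave_contDiff m).continuous
      exact Continuous.aestronglyMeasurable (by fun_prop)
    · refine Eventually.of_forall fun x _ => ?_
      rw [norm_mul]
      exact (mul_le_of_le_one_right (norm_nonneg _) (Real.abs_cos_le_one _)).trans
        (norm_pow_mul_le hs (abs_wave_le hC hq hb m x))
    · exact Eventually.of_forall fun x _ => hsum
    · exact intervalIntegrable_const
    · exact Eventually.of_forall fun x _ =>
        (summable_wave hC hq hρ hb hs x).hasSum.mul_right _
  refine h.unique ?_
  have hz : ∀ m : ℕ, m ≠ 0 → ∫ x in (0 : ℝ)..(2 * π), s ^ m * Ψ m x * Real.cos (n * x) = 0 := by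
    intro m hm
    have := hB.wave_orthogonal m (Nat.one_le_iff_ne_zero.2 hm)
    simp only [hB.wave_zero] at this
    simp only [mul_assoc, intervalIntegral.integral_const_mul, this, mul_zero]
  convert hasSum_single 0 hz using 1
  simp only [pow_zero, one_mul, hB.wave_zero, ← sq, integral_cos_sq_nat_mul hn]

theorem backgroundWaveDeriv_ne_zero (hB : IsBackgroundExpansion n Ψ V E) (hn : 0 < n)
    (hC : 0 ≤ C) (hq : 0 ≤ q) (hρ : ρ * q < 1)
    (hb : ∀ m, |E m| ≤ C * q ^ m ∧ ∀ x, |Ψ m x| ≤ C * q ^ m ∧ |V m x| ≤ C * q ^ m)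
    (hs : s ∈ Icc 0 ρ) {x : ℝ} (hx : backgroundWave Ψ s x = 0) :
    backgroundWaveDeriv Ψ s x ≠ 0 := by
  intro hx'
  have hθ : 0 ≤ ρ * q := mul_nonneg (hs.1.trans hs.2) hq
  have hbound : ∀ y, |n ^ 2 * ∑' m, s ^ m * (V m y - E m)|
      ≤ n ^ 2 * ∑' m : ℕ, 2 * C * ((m + 1) * (ρ * q) ^ m) := fun y => by
    rw [abs_mul, abs_of_nonneg (by positivity : (0 : ℝ) ≤ (n : ℝ) ^ 2)]
    gcongr
    exact tsum_of_norm_bounded (summable_succ_mul_geometric hθ hρ).hasSum fun m =>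
      norm_pow_mul_le hs ((abs_potential_sub_energy_le hb m y).trans (mul_le_mul_of_nonneg_left
        (le_mul_of_one_le_left (by positivity) (by linarith [(Nat.cast_nonneg m : (0 : ℝ) ≤ m)]))
        (by positivity)))
  have hzero := eq_zero_of_deriv_deriv_eq_mul (hB.hasDerivAt_backgroundWave hn hC hq hρ hb hs)
    (hB.hasDerivAt_backgroundWaveDeriv hn hC hq hρ hb hs) hbound hx hx'
  have := hB.integral_backgroundWave_mul_cos hn hC hq hρ hb hs
  simp only [hzero, zero_mul, intervalIntegral.integral_zero] at this
  exact Real.pi_ne_zero this.symm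

/-! ### Symmetries and nodes of the summed wave -/

theorem backgroundWave_neg (hB : IsBackgroundExpansion n Ψ V E) (s x : ℝ) :
    backgroundWave Ψ s (-x) = backgroundWave Ψ s x :=
  tsum_congr fun m => by rw [hB.wave_even]

/-- No convergence is needed: `tsum_neg` is compatible with the default value `0` of a divergent
sum. -/
theorem backgroundWave_reflect (hB : IsBackgroundExpansion n Ψ V E) (hn : 0 < n) (s x : ℝ) :
    backgroundWave Ψ s (π / n - x) = -backgroundWave Ψ s x := by
  unfold backgroundWave
  rw [← tsum_neg]
  exact tsum_congr fun m => by rw [(hB.wave_and_potential_reflect hn m).1, mul_neg]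

theorem backgroundWave_antiperiodic (hB : IsBackgroundExpansion n Ψ V E) (hn : 0 < n) (s : ℝ) :
    Function.Antiperiodic (backgroundWave Ψ s) (π / n) := fun x => by
  rw [← hB.backgroundWave_neg s x, ← hB.backgroundWave_reflect hn, sub_neg_eq_add, add_comm]

theorem backgroundWave_midpoint (hB : IsBackgroundExpansion n Ψ V E) (hn : 0 < n) (s : ℝ) :
    backgroundWave Ψ s (π / (2 * n)) = 0 := by
  have hn' : (n : ℝ) ≠ 0 := by positivity
  have h := hB.backgroundWave_reflect hn s (π / (2 * n))
  rw [show π / n - π / (2 * n) = π / (2 * n) by field_simp; ring] at h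
  linarith

/-- The continuity method over the connected parameter space `[0, ρ]`, started at `s = 0` with `cos
(n x)`. The majorant in `ρ` serves all `s ≤ ρ` and gives joint continuity. -/
theorem backgroundWave_pos (hB : IsBackgroundExpansion n Ψ V E) (hn : 0 < n) (hC : 0 ≤ C)
    (hq : 0 ≤ q) (hρ0 : 0 ≤ ρ) (hρ : ρ * q < 1)
    (hb : ∀ m, |E m| ≤ C * q ^ m ∧ ∀ x, |Ψ m x| ≤ C * q ^ m ∧ |V m x| ≤ C * q ^ m)
    {x : ℝ} (hx : x ∈ Ico 0 (π / (2 * n))) : 0 < backgroundWave Ψ ρ x := by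
  have hn' : (0 : ℝ) < n := by positivity
  have hθ : 0 ≤ ρ * q := mul_nonneg hρ0 hq
  have : PreconnectedSpace (Icc 0 ρ) := Subtype.preconnectedSpace isPreconnected_Icc
  have hP : Continuous fun z : Icc 0 ρ × ℝ => backgroundWave Ψ z.1 z.2 := by
    refine continuous_tsum (fun m => ?_) (summable_succ_mul_geometric hθ hρ)
      fun m z => norm_pow_mul_le z.1.2 (abs_wave_le hC hq hb m z.2)
    have := (hB.wave_contDiff m).continuous
    fun_prop
  have hD : Continuous fun z : Icc 0 ρ × ℝ => backgroundWaveDeriv Ψ z.1 z.2 := by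
    refine continuous_tsum (fun m => ?_) (summable_succ_mul_geometric hθ hρ)
      fun m z => norm_pow_mul_le z.1.2 (hB.abs_deriv_wave_le hn hC hq hb m z.2)
    have := (hB.wave_contDiff m).continuous_deriv (by norm_num)
    fun_prop
  refine pos_on_Ico_of_simple_zeros (X := Icc 0 ρ) (P := fun s => backgroundWave Ψ s)
    (D := fun s => backgroundWaveDeriv Ψ s) hP hD
    (fun s => hB.hasDerivAt_backgroundWave hn hC hq hρ hb s.2)
    (fun s => hB.backgroundWave_midpoint hn s)
    (fun s => by simp [backgroundWaveDeriv, hB.deriv_wave_zero])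
    (fun s x => hB.backgroundWaveDeriv_ne_zero hn hC hq hρ hb s.2)
    (s₀ := ⟨0, left_mem_Icc.2 hρ0⟩) (fun y hy => ?_) ⟨ρ, right_mem_Icc.2 hρ0⟩ x hx
  have h0 : backgroundWave Ψ 0 y = Real.cos (n * y) := by
    unfold backgroundWave
    rw [tsum_eq_single 0 fun m hm => by simp [hm]]
    simp [hB.wave_zero]
  change 0 ≤ backgroundWave Ψ 0 y
  rw [h0]
  have h1 : n * y ≤ n * (π / (2 * n)) := by gcongr; exact hy.2
  rw [show (n : ℝ) * (π / (2 * n)) = π / 2 by field_simp] at h1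
  exact Real.cos_nonneg_of_neg_pi_div_two_le_of_le
    (by have := mul_nonneg hn'.le hy.1; linarith [Real.pi_pos]) h1

/-- In every lattice cell the only node is the midpoint. -/
theorem backgroundWave_eq_zero_iff (hB : IsBackgroundExpansion n Ψ V E) (hn : 0 < n) (hC : 0 ≤ C)
    (hq : 0 ≤ q) (hρ0 : 0 ≤ ρ) (hρ : ρ * q < 1)
    (hb : ∀ m, |E m| ≤ C * q ^ m ∧ ∀ x, |Ψ m x| ≤ C * q ^ m ∧ |V m x| ≤ C * q ^ m)
    (k : ℤ) {x : ℝ} (hx : x ∈ Icc (k * (π / n)) ((k + 1) * (π / n))) :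
    backgroundWave Ψ ρ x = 0 ↔ x = (2 * k + 1) * (π / (2 * n)) := by
  have hn' : (0 : ℝ) < n := by positivity
  have hpos := fun y => hB.backgroundWave_pos hn hC hq hρ0 hρ hb (x := y)
  have hcell : ∀ y ∈ Icc 0 (π / n), backgroundWave Ψ ρ y = 0 ↔ y = π / (2 * n) := by
    intro y hy
    have hhalf : π / n = π / (2 * n) + π / (2 * n) := by field_simp; ring
    refine ⟨fun h => ?_, fun h => h ▸ hB.backgroundWave_midpoint hn ρ⟩
    rcases lt_trichotomy y (π / (2 * n)) with hlt | heq | hgt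
    · exact absurd h (hpos y ⟨hy.1, hlt⟩).ne'
    · exact heq
    · have h1 := hpos (π / n - y) ⟨sub_nonneg.2 hy.2, by linarith⟩
      rw [hB.backgroundWave_reflect hn, h, neg_zero] at h1
      exact absurd h1 (lt_irrefl _)
  have hshift : backgroundWave Ψ ρ x = 0 ↔ backgroundWave Ψ ρ (x - k * (π / n)) = 0 := by
    have h := (hB.backgroundWave_antiperiodic hn ρ).sub_zsmul_eq (x := x) k
    rw [zsmul_eq_mul] at h
    rw [h]
    -- The translation costs only a sign `(-1) ^ k`, which does not affect zeros.
    rcases Int.even_or_odd k with e | e <;> simp [e, Int.negOnePow_even, Int.negOnePow_odd]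
  rw [hshift, hcell _ ⟨by linarith [hx.1], by linarith [hx.2]⟩, sub_eq_iff_eq_add]
  rw [show π / (2 * n) + k * (π / n) = (2 * k + 1) * (π / (2 * n)) by field_simp; ring]

end IsBackgroundExpansion

theorem mainTheorem6 (n : ℕ) (hn : 0 < n) (Ψ V : ℕ → ℝ → ℝ) (E : ℕ → ℝ)
    (hB : IsBackgroundExpansion n Ψ V E) (ρ : ℝ) (hρ0 : 0 ≤ ρ)
    (hρ : ENNReal.ofReal ρ < backgroundRadius Ψ V E) :
    (∀ x : ℝ, Summable fun m : ℕ => ρ ^ m * Ψ m x) ∧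
    {x : ℝ | x ∈ Set.Icc 0 (2 * Real.pi / n) ∧ backgroundWave Ψ ρ x = 0}
      = {Real.pi / (2 * n), 3 * Real.pi / (2 * n)} ∧
    ∀ k : ℤ,
      {x : ℝ | x ∈ Set.Icc (k * (Real.pi / n)) ((k + 1) * (Real.pi / n)) ∧
          backgroundWave Ψ ρ x = 0}
        = {(2 * k + 1) * (Real.pi / (2 * n))} := by
  obtain ⟨C, q, hC, hq, hρq, hb⟩ := hB.exists_geometric_bound hρ0 hρ
  have hn' : (0 : ℝ) < n := by positivity
  have hc : 0 < π / (2 * n) := by positivity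
  have h1 : π / n = 2 * (π / (2 * n)) := by field_simp
  have h2 : 2 * π / n = 4 * (π / (2 * n)) := by field_simp; ring
  have h3 : 3 * π / (2 * n) = 3 * (π / (2 * n)) := by ring
  have hiff := fun k x => hB.backgroundWave_eq_zero_iff hn hC hq hρ0 hρq hb k (x := x)
  refine ⟨IsBackgroundExpansion.summable_wave hC hq hρq hb ⟨hρ0, le_rfl⟩, ?_, fun k => ?_⟩
  · have hiff0 := hiff 0
    have hiff1 := hiff 1
    rw [h1] at hiff0 hiff1
    rw [h2, h3]
    ext x
    simp only [mem_ofPred_eq, mem_insert_iff, mem_singleton_iff]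
    push_cast at hiff0 hiff1
    constructor
    · rintro ⟨hx, h0⟩
      rcases le_total x (2 * (π / (2 * n))) with hle | hle
      · left
        have := (hiff0 x ⟨by linarith [hx.1], by linarith⟩).1 h0
        linarith
      · right
        have := (hiff1 x ⟨by linarith, by linarith [hx.2]⟩).1 h0
        linarith
    · rintro (rfl | rfl)
      · exact ⟨⟨by linarith, by linarith⟩,
          (hiff0 _ ⟨by linarith, by linarith⟩).2 (by linarith)⟩
      · exact ⟨⟨by linarith, by linarith⟩,
          (hiff1 _ ⟨by linarith, by linarith⟩).2 (by linarith)⟩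
  · ext x
    simp only [mem_ofPred_eq, mem_singleton_iff]
    refine ⟨fun h => (hiff k x h.1).1 h.2, fun h => ?_⟩
    have hx : x ∈ Icc (k * (π / n)) ((k + 1) * (π / n)) := by
      rw [h, h1]
      constructor <;> nlinarith
    exact ⟨hx, (hiff k x hx).2 h⟩
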